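/- Let $V=\{1,\dots,n\}$ and consider $n$ qubits with state space $\mathcal H^{\otimes n}$, $\mathcal H=\mathbb C^2$. For a permutation $\pi$ of $V$ let $U_\pi$ be the operator with $U_\pi(|q_1\rangle\otimes\dots\otimes|q_n\rangle)=|q_{\pi(1)}\rangle\otimes\dots\otimes|q_{\pi(n)}\rangle$ for $q_i\in\{0,1\}$, and let $U_{jk}$ be the operator $U_\pi$ for the transposition $\pi$ of $j$ and $k$. Let $\sigma$ be a piecewise constant map from $[0,\infty)$ to the set of simple graphs on $V$, with a positive lower bound $\tau_D$ on the time between consecutive switching instants (at a switching instant $\sigma$ takes the value of the piece that ends or of the piece that begins there), and write $\mathsf G_{\sigma(t)}=(V,\mathsf E_{\sigma(t)})$. Let $\hbar>0$, let $\alpha_{jk}>0$ be a constant weight for each pair $\{j,k\}$, and let $H$ be a Hermitian operator on $\mathcal H^{\otimes n}$. Consider the master equation $$\frac{d\rho}{dt}=-\frac{\imath}{\hbar}[H,\rho]+\sum_{\{j,k\}\in \mathsf E_{\sigma(t)}}\alpha_{jk}\big(U_{jk}\rho U_{jk}^\dagger-\rho\big),$$ whose solutions are continuous and satisfy the equation at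 all times other than switching instants. Let $\rho^k(t)$ denote the reduced state of qubit $k$, that is, the partial trace of $\rho(t)$ over all the other qubits. Suppose that $[H,U_\pi]=0$ for every permutation $\pi$ of $V$. (i) If the union graph $\big(V,\bigcup_{s\in[t,\infty)}\mathsf E_{\sigma(s)}\big)$ is connected for every $t\ge 0$, then global asymptotic reduced-state synchronization is achieved: for all $t_0\ge0$, all initial values $\rho(t_0)\in\mathbb C^{2^n\times 2^n}$ (in particular all density operators) and all $k,m\in V$, $\lim_{t\to\infty}\big(\rho^k(t)-\rho^m(t)\big)=0$. (ii) If there is a constant $T>0$ such that the union graph $\big(V,\bigcup_{s\in[t,t+T)}\mathsf E_{\sigma(s)}\big)$ is connected for every $t\ge 0$, then global exponential reduced-state synchronization is achieved: there are a constant $\gamma>0$ and, for each initial value $\rho_0\in\mathbb C^{2^n\times 2^n}$, a constant $C(\rho_0)>0$ such that for all $t_0\ge0$, the solution with $\rho(t_0)=\rho_0$ satisfies $\|\rho^k(t)-\rho^m(t)\|\le C(\rho_0)e^{-\gamma(t-t_0)}$ for all $t\ge t_0$ and all $k,m\in V$, where $\|\cdot\|$ is the Hilbert–Schmidt norm. Moreover,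 for every Hermitian operator $H_0$ on $\mathcal H$, both $H=H_0^{\otimes n}$ and the Kronecker sum $H=H_0^{\oplus n}=\sum_{i=1}^n I^{\otimes(i-1)}\otimes H_0\otimes I^{\otimes(n-i)}$ satisfy $[H,U_\pi]=0$ for every permutation $\pi$ of $V$. -/

import Mathlib

open Set Filter Topology

namespace QubitNetwork

/-- Basis labels of the `n`-qubit space: the string `q` stands for the computational basis vector
`|q₁⟩ ⊗ ⋯ ⊗ |qₙ⟩`. -/
abbrev Label (n : ℕ) : Type := Fin n → Fin 2

/-- Operators on the `n`-qubit space, as `2ⁿ × 2ⁿ` complex matrices in the computational basis. -/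
abbrev Op (n : ℕ) : Type := Matrix (Label n) (Label n) ℂ

/-- The permutation operator `U_π`: it sends `|q₁ … qₙ⟩` to `|q_{π(1)} … q_{π(n)}⟩`. -/
def permOp {n : ℕ} (π : Equiv.Perm (Fin n)) : Op n :=
  Matrix.of fun r q => if r = q ∘ π then 1 else 0

/-- The swapping operator `U_{jk}` of the qubits `j` and `k`. -/
def swapOp {n : ℕ} (j k : Fin n) : Op n := permOp (Equiv.swap j k)

/-- The tensor product `A₁ ⊗ ⋯ ⊗ Aₙ` of single-qubit operators. -/
def tensorOp {n : ℕ} (A : Fin n → Matrix (Fin 2) (Fin 2) ℂ) : Op n :=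
  Matrix.of fun r q => ∏ i, A i (r i) (q i)

/-- The tensor power `H₀ ⊗ ⋯ ⊗ H₀`, with `n` factors. -/
def tensorPow (n : ℕ) (H₀ : Matrix (Fin 2) (Fin 2) ℂ) : Op n :=
  tensorOp fun _ => H₀

/-- The Kronecker sum `∑ᵢ I ⊗ ⋯ ⊗ I ⊗ H₀ ⊗ I ⊗ ⋯ ⊗ I`, with `H₀` at place `i`. -/
def kroneckerSum (n : ℕ) (H₀ : Matrix (Fin 2) (Fin 2) ℂ) : Op n :=
  ∑ i : Fin n, tensorOp (Function.update (fun _ => 1) i H₀)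

/-- The reduced state of qubit `k`: the partial trace over all the other qubits. The label
`(Equiv.funSplitAt k (Fin 2)).symm (a, s)` has the bit `a` at `k` and the bits `s` elsewhere. -/
def reducedState {n : ℕ} (k : Fin n) (ρ : Op n) : Matrix (Fin 2) (Fin 2) ℂ :=
  Matrix.of fun a b => ∑ s : {j : Fin n // j ≠ k} → Fin 2,
    ρ ((Equiv.funSplitAt k (Fin 2)).symm (a, s)) ((Equiv.funSplitAt k (Fin 2)).symm (b, s))

/-- `σ` restricted to `[0, ∞)` is piecewise constant, and the lengths of its pieces are bounded
below by a positive dwell time `τ`. The pieces have the end points `s k` and `s (k + 1)`; at a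
switching instant `σ` takes the value of the piece that ends or of the piece that begins there.
(Instants `s k` at which `σ` does not change are allowed, so that finitely many switches, or none,
are covered.) -/
def IsSwitchingSignal {n : ℕ} (σ : ℝ → SimpleGraph (Fin n)) : Prop :=
  ∃ (τ : ℝ) (s : ℕ → ℝ) (g : ℕ → SimpleGraph (Fin n)),
    0 < τ ∧ s 0 = 0 ∧ (∀ k, s k + τ ≤ s (k + 1)) ∧
    (∀ k, ∀ t ∈ Ioo (s k) (s (k + 1)), σ t = g k) ∧
    σ 0 = g 0 ∧ ∀ k, σ (s (k + 1)) = g k ∨ σ (s (k + 1)) = g (k + 1)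

/-- The union graph over the time set `S`: its edges are those of all the `σ t` with `t ∈ S`. -/
def unionGraph {n : ℕ} (σ : ℝ → SimpleGraph (Fin n)) (S : Set ℝ) : SimpleGraph (Fin n) :=
  ⨆ t ∈ S, σ t

open Classical in
/-- The right-hand side of the synchronization master equation for the interaction graph `G`:
`-(i/ħ) [H, ρ] + ∑_{{j,k} ∈ E} α_{jk} (U_{jk} ρ U_{jk}† - ρ)`. Every edge is counted once, as the
pair of its end points in increasing order. -/
noncomputable def masterRHS {n : ℕ} (ħ : ℝ) (H : Op n) (α : Sym2 (Fin n) → ℝ)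
    (G : SimpleGraph (Fin n)) (ρ : Op n) : Op n :=
  -(Complex.I / (ħ : ℂ)) • (H * ρ - ρ * H) +
    ∑ p : Fin n × Fin n with p.1 < p.2 ∧ G.Adj p.1 p.2,
      (α s(p.1, p.2) : ℂ) • (swapOp p.1 p.2 * ρ * (swapOp p.1 p.2).conjTranspose - ρ)

/-- `ρ` is a solution on `[t₀, ∞)` of the master equation with the switching graph `σ`: it is
continuous and satisfies the equation at all times that are not switching instants of `σ`. -/
structure IsSolution {n : ℕ} (ħ : ℝ) (H : Op n) (α : Sym2 (Fin n) → ℝ)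
    (σ : ℝ → SimpleGraph (Fin n)) (t₀ : ℝ) (ρ : ℝ → Op n) : Prop where
  continuousOn : ContinuousOn ρ (Ici t₀)
  hasDerivAt : ∀ t, t₀ < t → (∀ᶠ s in 𝓝 t, σ s = σ t) →
    HasDerivAt ρ (masterRHS ħ H α (σ t) (ρ t)) t

/-- Global asymptotic reduced-state synchronization. The initial value `ρ t₀` is an arbitrary
`2ⁿ × 2ⁿ` matrix, in particular any density operator. -/
def AsymptoticSync {n : ℕ} (ħ : ℝ) (H : Op n) (α : Sym2 (Fin n) → ℝ)
    (σ : ℝ → SimpleGraph (Fin n)) : Prop :=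
  ∀ t₀ : ℝ, 0 ≤ t₀ → ∀ ρ : ℝ → Op n, IsSolution ħ H α σ t₀ ρ →
    ∀ k m : Fin n,
      Tendsto (fun t => reducedState k (ρ t) - reducedState m (ρ t)) atTop (𝓝 0)

open scoped Matrix.Norms.Frobenius in
/-- Global exponential reduced-state synchronization: the rate `γ` is common to all solutions, and
the constant `C` depends on the initial value only. The norm is the Hilbert-Schmidt norm. -/
def ExponentialSync {n : ℕ} (ħ : ℝ) (H : Op n) (α : Sym2 (Fin n) → ℝ)
    (σ : ℝ → SimpleGraph (Fin n)) : Prop :=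
  ∃ γ : ℝ, 0 < γ ∧ ∀ ρ₀ : Op n, ∃ C : ℝ, 0 < C ∧
    ∀ t₀ : ℝ, 0 ≤ t₀ → ∀ ρ : ℝ → Op n, IsSolution ħ H α σ t₀ ρ → ρ t₀ = ρ₀ →
      ∀ k m : Fin n, ∀ t : ℝ, t₀ ≤ t →
        ‖reducedState k (ρ t) - reducedState m (ρ t)‖ ≤ C * Real.exp (-γ * (t - t₀))

end QubitNetwork

/-!
The argument is a Hilbert-space one and treats the master equation directly, Hamiltonian included.
With the Hilbert-Schmidt inner product the space of operators is a finite-dimensional real Hilbert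
space, `ρ ↦ -(i/ħ)[H, ρ]` is skew, and each swap `ρ ↦ U ρ U†` is an isometry which commutes with it
because `H` is permutation invariant. This is the setting of `ConsensusSystem`.

For a set `J` of pairs let `V_J ρ` be the squared distance from `ρ` to the space fixed by the swaps
in `J` (`ConsensusSystem.disagreement`). While the interaction graph is contained in `J`, `V_J` does
not increase; its derivative is minus the dissipation `∑ α ‖UρU† - ρ‖²` of the active edges. In
particular the total disagreement `V`, taken for all pairs, is a Lyapunov function. For an arbitrary
graph, `V_J' ≤ W V_J + dissipation`, with `W` the sum of the weights.

Suppose a graph `g` is active for a time at least `τ`. By the mean value theorem the dissipation is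
at some moment at most `1/τ` times the loss of `V`; by Gronwall's inequality `V_J` is then still
controlled by its initial value and the loss of `V`; and by finite dimensionality `V_{J ∪ g}` is at
most a constant times `V_J` plus the dissipation (`exists_disagreement_step`). If `g` adds nothing to
`J`, the estimate for `V_J` persists without any loss. So along a switching sequence the constant is
multiplied only when the set of pairs seen so far grows, which happens boundedly often. Once the
pairs seen so far form a connected graph, their swaps have the same fixed space as all swaps, and
the estimate becomes `V(end) ≤ D (V(start) - V(end))`: a contraction by a factor `q < 1` that does not
depend on the length of the window (`exists_contraction`). Windows of arbitrary length yield
convergence, windows of bounded length yield an exponential rate. Finally, an operator fixed by all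
swaps has equal reduced states, so their difference is bounded by `√V`.
-/

/-! ### Linear systems driven by commuting isometries -/

theorem LinearMap.exists_norm_le_of_finiteDimensional {E F : Type*} [NormedAddCommGroup E]
    [NormedSpace ℝ E] [FiniteDimensional ℝ E] [NormedAddCommGroup F] [NormedSpace ℝ F]
    (f : E →ₗ[ℝ] F) : ∃ C : ℝ, 0 ≤ C ∧ ∀ x, ‖f x‖ ≤ C * ‖x‖ :=
  ⟨‖LinearMap.toContinuousLinearMap f‖, norm_nonneg _,
    (LinearMap.toContinuousLinearMap f).le_opNorm⟩

/-- A linear system `ẋ = K x + ∑_{e ∈ g} w_e (T_e x - x)` on a real inner product space, where the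
set `g` of active indices may be switched: the drift `K` is skew, the `T_e` are isometries commuting
with `K`, and the weights `w_e` are positive. -/
structure ConsensusSystem (E ι : Type*) [NormedAddCommGroup E] [InnerProductSpace ℝ E] where
  drift : E →ₗ[ℝ] E
  act : ι → E →ₗ[ℝ] E
  weight : ι → ℝ
  inner_drift : ∀ x, inner ℝ x (drift x) = 0
  norm_act : ∀ e x, ‖act e x‖ = ‖x‖
  drift_act : ∀ e x, drift (act e x) = act e (drift x)
  weight_pos : ∀ e, 0 < weight e

namespace ConsensusSystem

variable {E ι : Type*} [NormedAddCommGroup E] [InnerProductSpace ℝ E] (S : ConsensusSystem E ι)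

/-- The vectors fixed by all `T_e` with `e ∈ J`. -/
def fixedSpace (J : Finset ι) : Submodule ℝ E where
  carrier := {x | ∀ e ∈ J, S.act e x = x}
  add_mem' := fun hx hy e he => by rw [map_add, hx e he, hy e he]
  zero_mem' := fun e _ => map_zero _
  smul_mem' := fun c x hx e he => by rw [map_smul, hx e he]

theorem mem_fixedSpace {J : Finset ι} {x : E} :
    x ∈ S.fixedSpace J ↔ ∀ e ∈ J, S.act e x = x := Iff.rfl

/-- The right-hand side of the system when `g` is the set of active indices. -/
def field (g : Finset ι) (x : E) : E :=
  S.drift x + ∑ e ∈ g, S.weight e • (S.act e x - x)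

/-- The rate at which the active indices dissipate the energy: minus the derivative of `‖x‖²`, or
of the disagreement over any set that contains `g`, along the system. -/
def dissipation (g : Finset ι) (x : E) : ℝ :=
  ∑ e ∈ g, S.weight e * ‖S.act e x - x‖ ^ 2

theorem dissipation_nonneg (g : Finset ι) (x : E) : 0 ≤ S.dissipation g x :=
  Finset.sum_nonneg fun e _ => mul_nonneg (S.weight_pos e).le (sq_nonneg _)

/-- Only `‖T_e x‖ = ‖x‖` is used here: `T_e` need not be symmetric. -/
theorem inner_act_sub_self (e : ι) (x : E) :
    inner ℝ x (S.act e x - x) = -(‖S.act e x - x‖ ^ 2) / 2 := by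
  have h := norm_sub_sq_real (S.act e x) x
  rw [S.norm_act, real_inner_comm] at h
  rw [inner_sub_right, real_inner_self_eq_norm_sq]
  linarith

variable [FiniteDimensional ℝ E]

/-- The orthogonal projection onto the complement of the space fixed by `J`. -/
noncomputable def residual (J : Finset ι) : E →L[ℝ] E := (S.fixedSpace J)ᗮ.starProjection

/-- The squared distance to the space fixed by `J`. -/
noncomputable def disagreement (J : Finset ι) (x : E) : ℝ := ‖S.residual J x‖ ^ 2

theorem disagreement_nonneg (J : Finset ι) (x : E) : 0 ≤ S.disagreement J x := sq_nonneg _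

theorem residual_mem (J : Finset ι) (x : E) : S.residual J x ∈ (S.fixedSpace J)ᗮ :=
  Submodule.starProjection_apply_mem _ _

theorem sub_residual_mem (J : Finset ι) (x : E) : x - S.residual J x ∈ S.fixedSpace J := by
  have := Submodule.sub_starProjection_mem_orthogonal (K := (S.fixedSpace J)ᗮ) x
  rwa [Submodule.orthogonal_orthogonal] at this

theorem act_residual_sub {J : Finset ι} {e : ι} (he : e ∈ J) (x : E) :
    S.act e (S.residual J x) - S.residual J x = S.act e x - x := by
  have h := S.sub_residual_mem J x e he
  rw [map_sub] at h
  rw [sub_eq_sub_iff_sub_eq_sub, ← neg_sub (S.act e x), h, neg_sub]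

theorem inner_residual_left (J : Finset ι) (x y : E) :
    inner ℝ (S.residual J x) (S.residual J y) = inner ℝ (S.residual J x) y := by
  have h := Submodule.inner_left_of_mem_orthogonal (S.sub_residual_mem J y) (S.residual_mem J x)
  rw [inner_sub_right] at h
  linarith

/-- The drift preserves the space fixed by `J`, and therefore does not change the disagreement. -/
theorem inner_residual_drift (J : Finset ι) (x : E) :
    inner ℝ (S.residual J x) (S.drift x) = 0 := by
  have h : S.drift (x - S.residual J x) ∈ S.fixedSpace J := fun e he => by
    rw [← S.drift_act, S.sub_residual_mem J x e he]
  have h' := Submodule.inner_left_of_mem_orthogonal h (S.residual_mem J x)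
  rw [map_sub, inner_sub_right, S.inner_drift, sub_zero] at h'
  exact h'

/-- The derivative of the disagreement over `J` while all active indices lie in `J`. -/
theorem two_inner_residual_field_of_subset {J g : Finset ι} (h : g ⊆ J) (x : E) :
    2 * inner ℝ (S.residual J x) (S.field g x) = -S.dissipation g x := by
  rw [field, inner_add_right, S.inner_residual_drift, zero_add, inner_sum, dissipation,
    Finset.mul_sum, ← Finset.sum_neg_distrib]
  refine Finset.sum_congr rfl fun e he => ?_
  rw [inner_smul_right, ← S.act_residual_sub (h he), S.inner_act_sub_self]
  ring

/-- A bound for the derivative of the disagreement over `J` under arbitrary active indices. -/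
theorem two_inner_residual_field_le [Fintype ι] (J g : Finset ι) (x : E) :
    2 * inner ℝ (S.residual J x) (S.field g x) ≤
      (∑ e, S.weight e) * S.disagreement J x + S.dissipation g x := by
  have h1 : 2 * inner ℝ (S.residual J x) (S.field g x) ≤
      ∑ e ∈ g, (S.weight e * S.disagreement J x + S.weight e * ‖S.act e x - x‖ ^ 2) := by
    rw [field, inner_add_right, S.inner_residual_drift, zero_add, inner_sum, Finset.mul_sum]
    refine Finset.sum_le_sum fun e _ => ?_
    rw [inner_smul_right, disagreement]
    have := real_inner_le_norm (S.residual J x) (S.act e x - x)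
    have h2 := two_mul_le_add_sq ‖S.residual J x‖ ‖S.act e x - x‖
    have h3 := (S.weight_pos e).le
    nlinarith
  rw [Finset.sum_add_distrib, ← Finset.sum_mul] at h1
  refine h1.trans (add_le_add_left (mul_le_mul_of_nonneg_right ?_ (S.disagreement_nonneg J x)) _)
  exact Finset.sum_le_sum_of_subset_of_nonneg (Finset.subset_univ _)
    fun e _ _ => (S.weight_pos e).le

/-- The linear map `x ↦ (residual of x over J, (√w_e (T_e x - x))_{e ∈ g})` has the space fixed by
`J ∪ g` as its kernel, hence is bounded below on the orthogonal complement of that space. -/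
theorem exists_disagreement_union_le [DecidableEq ι] [Fintype ι] (J g : Finset ι) :
    ∃ C : ℝ, 0 ≤ C ∧ ∀ x, S.disagreement (J ∪ g) x ≤
      C * (S.disagreement J x + S.dissipation g x) := by
  let A : E →ₗ[ℝ] E × (ι → E) := (S.residual J : E →ₗ[ℝ] E).prod
    (LinearMap.pi fun e => if e ∈ g then √(S.weight e) • (S.act e - LinearMap.id) else 0)
  have hA : ∀ x, ‖A x‖ ^ 2 ≤ S.disagreement J x + S.dissipation g x := by
    intro x
    have h1 := S.disagreement_nonneg J x
    have h2 := S.dissipation_nonneg g x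
    have h3 : ‖A x‖ ≤ √(S.disagreement J x + S.dissipation g x) := by
      refine norm_prod_le_iff.2 ⟨Real.le_sqrt_of_sq_le (le_add_of_nonneg_right h2), ?_⟩
      refine (pi_norm_le_iff_of_nonneg (Real.sqrt_nonneg _)).2 fun e => ?_
      by_cases he : e ∈ g
      · refine Real.le_sqrt_of_sq_le (le_add_of_nonneg_of_le h1 ?_)
        have h4 : ((A x).2 e) = √(S.weight e) • (S.act e x - x) := by simp [A, he]
        rw [h4, norm_smul, mul_pow, Real.norm_eq_abs, sq_abs, Real.sq_sqrt (S.weight_pos e).le]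
        exact Finset.single_le_sum (f := fun e => S.weight e * ‖S.act e x - x‖ ^ 2)
          (fun e _ => mul_nonneg (S.weight_pos e).le (sq_nonneg _)) he
      · have h4 : ((A x).2 e) = 0 := by simp [A, he]
        rw [h4, norm_zero]; exact Real.sqrt_nonneg _
    calc _ ≤ (√(S.disagreement J x + S.dissipation g x)) ^ 2 := by gcongr
      _ = _ := Real.sq_sqrt (by positivity)
  have hker : LinearMap.ker A = S.fixedSpace (J ∪ g) := by
    ext x
    have h1 : S.residual J x = 0 ↔ ∀ e ∈ J, S.act e x = x := by
      rw [← mem_fixedSpace, residual, Submodule.starProjection_apply_eq_zero_iff,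
        Submodule.orthogonal_orthogonal]
    have h2 : x ∈ S.fixedSpace (J ∪ g) ↔
        (∀ e ∈ J, S.act e x = x) ∧ ∀ e ∈ g, S.act e x = x := by
      simp only [mem_fixedSpace, Finset.mem_union, or_imp, forall_and]
    rw [h2, ← h1, LinearMap.mem_ker]
    refine Prod.mk_eq_zero.trans (and_congr_right fun _ => ?_)
    rw [funext_iff]
    refine forall_congr' fun e => ?_
    by_cases he : e ∈ g
    · simp [he, (Real.sqrt_pos.2 (S.weight_pos e)).ne', sub_eq_zero]
    · simp [he]
  obtain ⟨k, -, hk⟩ := LinearMap.exists_antilipschitzWith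
    (A.domRestrict (S.fixedSpace (J ∪ g))ᗮ) (by
      rw [LinearMap.ker_domRestrict, hker, Submodule.eq_bot_iff]
      intro x hx
      exact Subtype.ext (inner_self_eq_zero.1 (Submodule.inner_right_of_mem_orthogonal hx x.2)))
  refine ⟨k ^ 2, sq_nonneg _, fun x => ?_⟩
  have h1 : A (S.residual (J ∪ g) x) = A x := by
    have h : x - S.residual (J ∪ g) x ∈ LinearMap.ker A := hker ▸ S.sub_residual_mem _ x
    rw [LinearMap.mem_ker, map_sub, sub_eq_zero] at h
    exact h.symm
  have h2 : ‖S.residual (J ∪ g) x‖ ≤ k * ‖A x‖ := by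
    have h := hk.le_mul_dist ⟨_, S.residual_mem (J ∪ g) x⟩ 0
    rwa [map_zero, dist_zero_right, dist_zero_right, LinearMap.domRestrict_apply, h1] at h
  calc S.disagreement (J ∪ g) x ≤ (k * ‖A x‖) ^ 2 := pow_le_pow_left₀ (norm_nonneg _) h2 2
    _ = k ^ 2 * ‖A x‖ ^ 2 := mul_pow _ _ _
    _ ≤ _ := by gcongr; exact hA x

variable {S} {x : ℝ → E} {g J : Finset ι} {u v : ℝ}

theorem hasDerivAt_disagreement (J : Finset ι) {y : E} {t : ℝ} (h : HasDerivAt x y t) :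
    HasDerivAt (fun t => S.disagreement J (x t)) (2 * inner ℝ (S.residual J (x t)) y) t := by
  have h1 := ((S.residual J).hasFDerivAt.comp_hasDerivAt t h).norm_sq
  rwa [Function.comp_apply, S.inner_residual_left] at h1

theorem continuousOn_disagreement (J : Finset ι) {s : Set ℝ} (h : ContinuousOn x s) :
    ContinuousOn (fun t => S.disagreement J (x t)) s :=
  ((S.residual J).continuous.comp_continuousOn h).norm.pow 2

theorem antitoneOn_disagreement (hc : ContinuousOn x (Icc u v))
    (hd : ∀ t ∈ Ioo u v, HasDerivAt x (S.field g (x t)) t) (hg : g ⊆ J) :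
    AntitoneOn (fun t => S.disagreement J (x t)) (Icc u v) := by
  refine antitoneOn_of_hasDerivWithinAt_nonpos (convex_Icc u v)
    (continuousOn_disagreement J hc)
    (f' := fun t => -S.dissipation g (x t)) (fun t ht => ?_) (fun t _ => ?_)
  · rw [interior_Icc] at ht
    have := hasDerivAt_disagreement (S := S) J (hd t ht)
    rw [S.two_inner_residual_field_of_subset hg] at this
    exact this.hasDerivWithinAt
  · exact neg_nonpos.2 (S.dissipation_nonneg _ _)

variable [Fintype ι]

/-- A Gronwall estimate: a period of activity of `g` raises the disagreement over `J` by no more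
than what the total disagreement loses, up to an exponential factor. -/
theorem disagreement_add_le_exp (hc : ContinuousOn x (Icc u v))
    (hd : ∀ t ∈ Ioo u v, HasDerivAt x (S.field g (x t)) t) (J : Finset ι) {t : ℝ}
    (ht : t ∈ Icc u v) :
    S.disagreement J (x t) ≤ Real.exp ((∑ e, S.weight e) * (t - u)) *
      (S.disagreement J (x u) +
        (S.disagreement Finset.univ (x u) - S.disagreement Finset.univ (x v))) := by
  set W := ∑ e, S.weight e with hW
  have hW0 : 0 ≤ W := Finset.sum_nonneg fun e _ => (S.weight_pos e).le
  have hE := antitoneOn_disagreement hc hd (Finset.subset_univ g)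
  have huv : u ≤ v := ht.1.trans ht.2
  -- The sum of `V_J` and the total disagreement satisfies `F' ≤ W F`, as the dissipation cancels.
  set F : ℝ → ℝ := fun t => S.disagreement J (x t) +
    (S.disagreement Finset.univ (x t) - S.disagreement Finset.univ (x v)) with hF
  have hmono : AntitoneOn (fun t => Real.exp (-W * (t - u)) * F t) (Icc u v) := by
    refine antitoneOn_of_hasDerivWithinAt_nonpos (convex_Icc u v) ?_
      (f' := fun t => Real.exp (-W * (t - u)) * (-W * 1) * F t + Real.exp (-W * (t - u)) *
        (2 * inner ℝ (S.residual J (x t)) (S.field g (x t)) + (-S.dissipation g (x t))))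
      (fun s hs => ?_) (fun s hs => ?_)
    · refine ContinuousOn.mul (by fun_prop) ?_
      exact (continuousOn_disagreement J hc).add
        ((continuousOn_disagreement Finset.univ hc).sub continuousOn_const)
    · rw [interior_Icc] at hs
      have h2 := hasDerivAt_disagreement (S := S) Finset.univ (hd s hs)
      rw [S.two_inner_residual_field_of_subset (Finset.subset_univ g)] at h2
      exact (((((hasDerivAt_id s).sub_const u).const_mul (-W)).exp).mul
        ((hasDerivAt_disagreement J (hd s hs)).add (h2.sub_const _))).hasDerivWithinAt
    · rw [interior_Icc] at hs
      have h1 := S.two_inner_residual_field_le J g (x s)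
      have h2 : S.disagreement Finset.univ (x v) ≤ S.disagreement Finset.univ (x s) :=
        hE (Ioo_subset_Icc_self hs) (right_mem_Icc.2 huv) hs.2.le
      have h3 := mul_nonneg hW0 (sub_nonneg.2 h2)
      have h4 : Real.exp (-W * (s - u)) * (-W * 1) * F s + Real.exp (-W * (s - u)) *
        (2 * inner ℝ (S.residual J (x s)) (S.field g (x s)) + (-S.dissipation g (x s))) =
        Real.exp (-W * (s - u)) * (-W * F s +
        (2 * inner ℝ (S.residual J (x s)) (S.field g (x s)) + (-S.dissipation g (x s)))) := by
        ring
      rw [h4]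
      refine mul_nonpos_of_nonneg_of_nonpos (Real.exp_pos _).le ?_
      simp only [hF]
      linarith
  have h1 := hmono (left_mem_Icc.2 huv) ht ht.1
  simp only [sub_self, mul_zero, Real.exp_zero, one_mul] at h1
  have h2 : S.disagreement J (x t) ≤ F t :=
    le_add_of_nonneg_right (sub_nonneg.2 (hE ht (right_mem_Icc.2 huv) ht.2))
  refine h2.trans ?_
  have h3 : F t = Real.exp (W * (t - u)) * (Real.exp (-W * (t - u)) * F t) := by
    rw [← mul_assoc, ← Real.exp_add]; simp
  rw [h3]
  exact mul_le_mul_of_nonneg_left h1 (Real.exp_pos _).le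

section

variable (S) [DecidableEq ι]

/-- Activity of `g` for at least the dwell time `τ` extends control of the disagreement from `J` to
`J ∪ g`, with a constant that depends on `τ` and the system only. -/
theorem exists_disagreement_step {τ : ℝ} (hτ : 0 < τ) : ∃ M : ℝ, 1 ≤ M ∧
    ∀ (x : ℝ → E) (J g : Finset ι) (u v : ℝ), u + τ ≤ v → ContinuousOn x (Icc u v) →
      (∀ t ∈ Ioo u v, HasDerivAt x (S.field g (x t)) t) →
      S.disagreement (J ∪ g) (x v) ≤ M * (S.disagreement J (x u) +
        (S.disagreement Finset.univ (x u) - S.disagreement Finset.univ (x v))) := by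
  choose C hC0 hC using fun p : Finset ι × Finset ι => S.exists_disagreement_union_le p.1 p.2
  set W := ∑ e, S.weight e with hW
  have hW0 : 0 ≤ W := Finset.sum_nonneg fun e _ => (S.weight_pos e).le
  have hsum : 0 ≤ ∑ p, C p := Finset.sum_nonneg fun p _ => hC0 p
  have hb : 0 ≤ Real.exp (W * τ) + 1 / τ := by positivity
  refine ⟨1 + (∑ p, C p) * (Real.exp (W * τ) + 1 / τ),
    le_add_of_nonneg_right (mul_nonneg hsum hb), fun x J g u v huv hc hd => ?_⟩
  have huτ : u < u + τ := lt_add_of_pos_right u hτ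
  have hsub : Icc u (u + τ) ⊆ Icc u v := Icc_subset_Icc_right huv
  have hE := antitoneOn_disagreement hc hd (Finset.subset_univ g)
  -- At some time in `(u, u + τ)` the dissipation equals its mean over that interval. The interval
  -- has length `τ` and not `v - u`, so that the Gronwall factor is bounded uniformly in `v`.
  obtain ⟨t, ht, hts⟩ := exists_hasDerivAt_eq_slope
    (fun t => S.disagreement Finset.univ (x t)) (fun t => -S.dissipation g (x t)) huτ
    (continuousOn_disagreement _ (hc.mono hsub)) (fun t ht => by
      have := hasDerivAt_disagreement (S := S) Finset.univ (hd t ⟨ht.1, ht.2.trans_le huv⟩)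
      rwa [S.two_inner_residual_field_of_subset (Finset.subset_univ g)] at this)
  have htv : t ∈ Icc u v := hsub (Ioo_subset_Icc_self ht)
  set Δ := S.disagreement Finset.univ (x u) - S.disagreement Finset.univ (x v) with hΔ
  have hEv : S.disagreement Finset.univ (x v) ≤ S.disagreement Finset.univ (x (u + τ)) :=
    hE (hsub (right_mem_Icc.2 huτ.le)) (right_mem_Icc.2 (huτ.le.trans huv)) huv
  have hΔ0 : 0 ≤ Δ := sub_nonneg.2 (hE (left_mem_Icc.2 (huτ.le.trans huv))
    (right_mem_Icc.2 (huτ.le.trans huv)) (huτ.le.trans huv))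
  have hdis : S.dissipation g (x t) ≤ 1 / τ * Δ := by
    rw [add_sub_cancel_left] at hts
    have : S.dissipation g (x t) = 1 / τ * (S.disagreement Finset.univ (x u) -
        S.disagreement Finset.univ (x (u + τ))) := by
      rw [neg_eq_iff_eq_neg.1 hts]; ring
    rw [this]
    exact mul_le_mul_of_nonneg_left (by linarith) (by positivity)
  have hV0 := S.disagreement_nonneg J (x u)
  have hV : S.disagreement J (x t) ≤ Real.exp (W * τ) * (S.disagreement J (x u) + Δ) := by
    refine (disagreement_add_le_exp hc hd J htv).trans ?_
    refine mul_le_mul_of_nonneg_right (Real.exp_le_exp.2 ?_) (by positivity)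
    exact mul_le_mul_of_nonneg_left (by linarith [ht.2]) hW0
  have hmono := antitoneOn_disagreement (J := J ∪ g) hc hd Finset.subset_union_right htv
    (right_mem_Icc.2 (huτ.le.trans huv)) htv.2
  have hCle : C (J, g) ≤ ∑ p, C p :=
    Finset.single_le_sum (fun p _ => hC0 p) (Finset.mem_univ _)
  have h1 : S.disagreement J (x t) + S.dissipation g (x t) ≤
      (Real.exp (W * τ) + 1 / τ) * (S.disagreement J (x u) + Δ) := by
    have : 0 ≤ 1 / τ * S.disagreement J (x u) := by positivity
    rw [add_mul]
    linarith
  calc S.disagreement (J ∪ g) (x v) ≤ S.disagreement (J ∪ g) (x t) := hmono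
    _ ≤ C (J, g) * (S.disagreement J (x t) + S.dissipation g (x t)) := hC (J, g) (x t)
    _ ≤ (∑ p, C p) * ((Real.exp (W * τ) + 1 / τ) * (S.disagreement J (x u) + Δ)) :=
      mul_le_mul hCle h1 (add_nonneg (S.disagreement_nonneg _ _) (S.dissipation_nonneg _ _)) hsum
    _ ≤ _ := by
      have : 0 ≤ S.disagreement J (x u) + Δ := by positivity
      rw [add_mul 1, one_mul, mul_assoc]
      exact le_add_of_nonneg_left this

/-- The factor `q` bounds the decay of the total disagreement over every finite sequence of pieces
`[u k, u (k + 1)]` of length at least `τ`, with active indices `g k`, whose active indices together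
fix no more than all indices do. Neither the number nor the length of the pieces matters. -/
def IsContractionFactor (τ q : ℝ) : Prop :=
  ∀ (x : ℝ → E) (u : ℕ → ℝ) (g : ℕ → Finset ι) (b : ℕ),
    (∀ k < b, u k + τ ≤ u (k + 1)) →
    (∀ k < b, ContinuousOn x (Icc (u k) (u (k + 1)))) →
    (∀ k < b, ∀ t ∈ Ioo (u k) (u (k + 1)), HasDerivAt x (S.field (g k) (x t)) t) →
    S.fixedSpace ((Finset.range b).biUnion g) = S.fixedSpace Finset.univ →
    S.disagreement Finset.univ (x (u b)) ≤ q * S.disagreement Finset.univ (x (u 0))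

theorem exists_contraction {τ : ℝ} (hτ : 0 < τ) :
    ∃ q : ℝ, 0 < q ∧ q < 1 ∧ S.IsContractionFactor τ q := by
  obtain ⟨M, hM, hstep⟩ := S.exists_disagreement_step hτ
  set D := M ^ Fintype.card ι with hD
  have hD1 : 1 ≤ D := one_le_pow₀ hM
  refine ⟨D / (1 + D), by positivity, (div_lt_one (by positivity)).2 (by linarith),
    fun x u g b hu hc hd hfix => ?_⟩
  -- The constant is multiplied by `M` only when the set of indices seen so far grows.
  have key : ∀ k ≤ b,
      S.disagreement Finset.univ (x (u k)) ≤ S.disagreement Finset.univ (x (u 0)) ∧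
      S.disagreement ((Finset.range k).biUnion g) (x (u k)) ≤
      M ^ ((Finset.range k).biUnion g).card *
        (S.disagreement Finset.univ (x (u 0)) - S.disagreement Finset.univ (x (u k))) := by
    intro k
    induction k with
    | zero =>
      intro _
      have h0 : S.residual ∅ = 0 := by
        have : S.fixedSpace ∅ = ⊤ := by
          rw [Submodule.eq_top_iff']; intro x e he; simp at he
        simp [residual, this]
      simp [disagreement, h0]
    | succ k ih =>
      intro hk
      obtain ⟨ih1, ih2⟩ := ih (Nat.le_of_succ_le hk)
      have hkb : k < b := hk
      have huk : u k ≤ u (k + 1) := by linarith [hu k hkb]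
      have hdec : S.disagreement Finset.univ (x (u (k + 1))) ≤
          S.disagreement Finset.univ (x (u k)) :=
        antitoneOn_disagreement (hc k hkb) (hd k hkb) (Finset.subset_univ _)
          (left_mem_Icc.2 huk) (right_mem_Icc.2 huk) huk
      refine ⟨hdec.trans ih1, ?_⟩
      rw [Finset.range_add_one, Finset.biUnion_insert, Finset.union_comm]
      set J := (Finset.range k).biUnion g with hJ
      by_cases hgJ : g k ⊆ J
      · rw [Finset.union_eq_left.2 hgJ]
        refine (antitoneOn_disagreement (hc k hkb) (hd k hkb) hgJ
          (left_mem_Icc.2 huk) (right_mem_Icc.2 huk) huk).trans (ih2.trans ?_)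
        gcongr
      · have hcard : J.card + 1 ≤ (J ∪ g k).card := by
          refine Finset.card_lt_card (Finset.ssubset_iff_subset_ne.2
            ⟨Finset.subset_union_left, fun h => hgJ ?_⟩)
          rw [h]; exact Finset.subset_union_right
        refine (hstep x J (g k) _ _ (hu k hkb) (hc k hkb) (hd k hkb)).trans ?_
        have hp : 1 ≤ M ^ J.card := one_le_pow₀ hM
        have h1 : S.disagreement J (x (u k)) + (S.disagreement Finset.univ (x (u k)) -
            S.disagreement Finset.univ (x (u (k + 1)))) ≤ M ^ J.card *
            (S.disagreement Finset.univ (x (u 0)) -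
              S.disagreement Finset.univ (x (u (k + 1)))) := by
          nlinarith
        calc _ ≤ M * (M ^ J.card * (S.disagreement Finset.univ (x (u 0)) -
              S.disagreement Finset.univ (x (u (k + 1))))) := by gcongr
          _ = M ^ (J.card + 1) * (S.disagreement Finset.univ (x (u 0)) -
              S.disagreement Finset.univ (x (u (k + 1)))) := by ring
          _ ≤ _ := by
            have : 0 ≤ S.disagreement Finset.univ (x (u 0)) -
              S.disagreement Finset.univ (x (u (k + 1))) := by linarith
            gcongr
  obtain ⟨h1, h2⟩ := key b le_rfl
  have h3 : S.disagreement ((Finset.range b).biUnion g) (x (u b)) =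
      S.disagreement Finset.univ (x (u b)) := by
    simp only [disagreement, residual, hfix]
  rw [h3] at h2
  have h4 : S.disagreement Finset.univ (x (u b)) ≤
      D * (S.disagreement Finset.univ (x (u 0)) - S.disagreement Finset.univ (x (u b))) :=
    h2.trans (mul_le_mul_of_nonneg_right
      (pow_le_pow_right₀ hM (Finset.card_le_univ _)) (sub_nonneg.2 h1))
  rw [div_mul_eq_mul_div, le_div_iff₀ (by positivity)]
  linarith

end

/-! ### Contraction over time windows of a switching sequence -/

variable {s : ℕ → ℝ} {gs : ℕ → Finset ι} {t₀ τ : ℝ}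

theorem antitoneOn_disagreement_Ici (hτ : 0 < τ) (hs : ∀ k, s k + τ ≤ s (k + 1)) (hs0 : s 0 ≤ t₀)
    (hlim : Tendsto s atTop atTop) (hc : ContinuousOn x (Ici t₀))
    (hd : ∀ k, ∀ t ∈ Ioo (s k) (s (k + 1)), t₀ < t → HasDerivAt x (S.field (gs k) (x t)) t) :
    AntitoneOn (fun t => S.disagreement Finset.univ (x t)) (Ici t₀) := by
  have key : ∀ k, AntitoneOn (fun t => S.disagreement Finset.univ (x t)) (Icc t₀ (s k)) := by
    intro k
    induction k with
    | zero =>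
      intro a ha b hb _
      have h1 : a = t₀ := le_antisymm (ha.2.trans hs0) ha.1
      have h2 : b = t₀ := le_antisymm (hb.2.trans hs0) hb.1
      rw [h1, h2]
    | succ k ih =>
      rcases le_total t₀ (s k) with h | h
      · have h1 : s k ≤ s (k + 1) := by linarith [hs k]
        rw [← Icc_union_Icc_eq_Icc h h1]
        refine ih.union_right (antitoneOn_disagreement (g := gs k)
          (hc.mono fun t ht => h.trans ht.1) (fun t ht => hd k t ht (h.trans_lt ht.1))
          (Finset.subset_univ _)) (isGreatest_Icc h) (isLeast_Icc h1)
      · exact antitoneOn_disagreement (g := gs k) (hc.mono fun t ht => ht.1)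
          (fun t ht => hd k t ⟨h.trans_lt ht.1, ht.2⟩ ht.1) (Finset.subset_univ _)
  intro a ha b hb hab
  obtain ⟨k, hk⟩ := (hlim.eventually_ge_atTop b).exists
  exact key k ⟨ha, hab.trans hk⟩ ⟨hb, hk⟩ hab

/-- The total disagreement contracts between `A` and `B` if `A` is followed by at least the time `τ`
in the piece `a` and each further piece of the window starts at least `τ` before `B`. The last piece
is cut off at `B`, as the pieces of the switching sequence may be arbitrarily long. -/
theorem disagreement_le_of_window [DecidableEq ι] {q : ℝ}
    (hq : S.IsContractionFactor τ q)
    (hmono : Monotone s) (hs : ∀ k, s k + τ ≤ s (k + 1))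
    (hc : ContinuousOn x (Ici t₀))
    (hd : ∀ k, ∀ t ∈ Ioo (s k) (s (k + 1)), t₀ < t → HasDerivAt x (S.field (gs k) (x t)) t)
    (hV : AntitoneOn (fun t => S.disagreement Finset.univ (x t)) (Ici t₀))
    (hτ : 0 < τ) {A B : ℝ} {a m : ℕ} (hA : t₀ ≤ A) (haA : s a ≤ A) (hAa : A + τ ≤ s (a + 1))
    (hAB : A + τ ≤ B) (hB : ∀ j < m, s (a + j) + τ ≤ B)
    (hfix : S.fixedSpace ((Finset.range m).biUnion fun j => gs (a + j)) =
      S.fixedSpace Finset.univ) :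
    S.disagreement Finset.univ (x B) ≤ q * S.disagreement Finset.univ (x A) := by
  set u : ℕ → ℝ := fun j => min (max A (s (a + j))) B with hu
  have hAu : ∀ j, A ≤ u j := fun j => le_min (le_max_left _ _) (by linarith)
  have hu0 : u 0 = A := by
    simp only [hu, add_zero, max_eq_left haA]
    exact min_eq_left (by linarith)
  have hsucc : ∀ j, A + τ ≤ s (a + (j + 1)) := fun j => hAa.trans (hmono (by omega))
  have hstep : ∀ j < m, u j + τ ≤ u (j + 1) := by
    intro j hj
    refine le_min ?_ ?_
    · refine (add_le_add_left (min_le_left _ _) τ).trans ?_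
      rw [← max_add_add_right]
      exact (max_le (hsucc j) (hs (a + j))).trans (le_max_right _ _)
    · refine (add_le_add_left (min_le_left _ _) τ).trans ?_
      rw [← max_add_add_right]
      exact max_le hAB (hB j hj)
  have huj : ∀ j < m, s (a + j) ≤ u j := fun j hj =>
    le_min (le_max_right _ _) (by linarith [hB j hj])
  have huj' : ∀ j, u (j + 1) ≤ s (a + j + 1) := fun j =>
    (min_le_left _ _).trans (max_le (by have := hsucc j; rw [← add_assoc] at this; linarith) le_rfl)
  have := hq x u (fun j => gs (a + j)) m hstep
    (fun j _ => hc.mono fun t ht => hA.trans ((hAu j).trans ht.1))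
    (fun j hj t ht => hd (a + j) t ⟨(huj j hj).trans_lt ht.1, ht.2.trans_le (huj' j)⟩
      ((hA.trans (hAu j)).trans_lt ht.1)) hfix
  rw [hu0] at this
  exact (hV (hA.trans (hAu m)) (hA.trans (by linarith)) (min_le_right _ _)).trans this

end ConsensusSystem

/-! ### The master equation as a consensus system -/

namespace QubitNetwork

open Matrix
open scoped Matrix.Norms.Frobenius

/-- The Hilbert-Schmidt inner product `Re tr(A† B)`; its norm is the Frobenius norm. -/
noncomputable abbrev hilbertSchmidtInner {n : ℕ} : InnerProductSpace ℝ (Op n) where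
  inner A B := (Aᴴ * B).trace.re
  norm_sq_eq_re_inner A := by
    rw [frobenius_norm_def, ← Real.sqrt_eq_rpow, Real.sq_sqrt (by positivity)]
    simp only [trace, Matrix.diag, mul_apply, conjTranspose_apply, RCLike.re_to_real,
      Complex.re_sum]
    rw [Finset.sum_comm]
    refine Finset.sum_congr rfl fun i _ => Finset.sum_congr rfl fun j _ => ?_
    rw [Real.rpow_two, Complex.sq_norm, Complex.normSq_apply]
    simp
  conj_inner_symm A B := by
    have h : (Bᴴ * A).trace = star (Aᴴ * B).trace := by
      rw [← trace_conjTranspose, conjTranspose_mul, conjTranspose_conjTranspose]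
    simp [h]
  add_left A B C := by simp [add_mul]
  smul_left A B r := by simp

attribute [local instance] hilbertSchmidtInner

theorem inner_eq {n : ℕ} (A B : Op n) : inner ℝ A B = (Aᴴ * B).trace.re := rfl

theorem permOp_mul_apply {n : ℕ} (π : Equiv.Perm (Fin n)) (A : Op n) (r q : Label n) :
    (permOp π * A) r q = A (r ∘ π.symm) q := by
  have h : ∀ s : Label n, r = s ∘ π ↔ r ∘ π.symm = s := fun s =>
    (Equiv.comp_symm_eq π s r).symm
  simp [permOp, mul_apply, h]

theorem mul_permOp_apply {n : ℕ} (π : Equiv.Perm (Fin n)) (A : Op n) (r q : Label n) :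
    (A * permOp π) r q = A r (q ∘ π) := by
  simp [permOp, mul_apply]

theorem conjTranspose_permOp {n : ℕ} (π : Equiv.Perm (Fin n)) :
    (permOp π)ᴴ = permOp π.symm := by
  ext r q
  have h : q = r ∘ π ↔ r = q ∘ π.symm := by
    rw [Equiv.eq_comp_symm, eq_comm]
  simp [permOp, conjTranspose_apply, h, apply_ite]

/-- The conjugation `A ↦ U_π A U_π†` by a permutation operator. -/
noncomputable def conjPerm {n : ℕ} (π : Equiv.Perm (Fin n)) : Op n →ₗ[ℝ] Op n where
  toFun A := permOp π * A * (permOp π)ᴴ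
  map_add' A B := by rw [mul_add, add_mul]
  map_smul' c A := by simp

theorem conjPerm_apply {n : ℕ} (π : Equiv.Perm (Fin n)) (A : Op n) :
    conjPerm π A = permOp π * A * (permOp π)ᴴ := rfl

theorem conjPerm_apply_apply {n : ℕ} (π : Equiv.Perm (Fin n)) (A : Op n) (r q : Label n) :
    conjPerm π A r q = A (r ∘ π.symm) (q ∘ π.symm) := by
  rw [conjPerm_apply, conjTranspose_permOp, mul_permOp_apply, permOp_mul_apply]

/-- Conjugation reverses products, as `U_π` acts on labels by composition on the right. -/
theorem conjPerm_mul {n : ℕ} (π π' : Equiv.Perm (Fin n)) (A : Op n) :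
    conjPerm (π * π') A = conjPerm π' (conjPerm π A) := by
  ext r q
  simp only [conjPerm_apply_apply]
  rfl

theorem norm_conjPerm {n : ℕ} (π : Equiv.Perm (Fin n)) (A : Op n) : ‖conjPerm π A‖ = ‖A‖ := by
  rw [frobenius_norm_def, frobenius_norm_def]
  congr 1
  simp only [conjPerm_apply_apply]
  refine (Equiv.sum_comp (Equiv.arrowCongr π.symm (Equiv.refl (Fin 2)))
    (fun r : Label n => ∑ q : Label n, ‖A (r ∘ π.symm) (q ∘ π.symm)‖ ^ (2 : ℝ))).symm.trans ?_
  refine Finset.sum_congr rfl fun r _ => ?_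
  refine (Equiv.sum_comp (Equiv.arrowCongr π.symm (Equiv.refl (Fin 2))) _).symm.trans ?_
  refine Finset.sum_congr rfl fun q _ => ?_
  congr 3 <;> ext i <;> simp

/-- The Hamiltonian part `A ↦ -(i/ħ)[H, A]` of the master equation. -/
noncomputable def hamDrift {n : ℕ} (ħ : ℝ) (H : Op n) : Op n →ₗ[ℝ] Op n where
  toFun A := -(Complex.I / (ħ : ℂ)) • (H * A - A * H)
  map_add' A B := by rw [← smul_add]; congr 1; noncomm_ring
  map_smul' c A := by
    rw [mul_smul_comm, smul_mul_assoc, ← smul_sub, smul_comm, RingHom.id_apply]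

theorem hamDrift_apply {n : ℕ} (ħ : ℝ) (H A : Op n) :
    hamDrift ħ H A = -(Complex.I / (ħ : ℂ)) • (H * A - A * H) := rfl

/-- The drift is skew: for Hermitian `H` the trace of `A† [H, A]` is real, and the prefactor is imaginary. -/
theorem inner_hamDrift {n : ℕ} (ħ : ℝ) {H : Op n} (hH : H.IsHermitian) (A : Op n) :
    inner ℝ A (hamDrift ħ H A) = 0 := by
  have hreal : (Aᴴ * (H * A - A * H)).trace.im = 0 := by
    rw [← Complex.conj_eq_iff_im, starRingEnd_apply, ← trace_conjTranspose, conjTranspose_mul,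
      conjTranspose_sub, conjTranspose_mul, conjTranspose_mul, conjTranspose_conjTranspose, hH.eq,
      sub_mul, mul_sub, trace_sub, trace_sub, mul_assoc, mul_assoc H, trace_mul_comm H,
      mul_assoc Aᴴ]
  rw [inner_eq, hamDrift_apply, mul_smul_comm, trace_smul, smul_eq_mul, Complex.mul_re, hreal]
  have : (-(Complex.I / (ħ : ℂ))).re = 0 := by simp [Complex.div_re]
  rw [this]; simp

theorem hamDrift_conjPerm {n : ℕ} (ħ : ℝ) {H : Op n} {π : Equiv.Perm (Fin n)}
    (h : Commute H (permOp π)) (hs : Commute H (permOp π.symm)) (A : Op n) :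
    hamDrift ħ H (conjPerm π A) = conjPerm π (hamDrift ħ H A) := by
  simp only [hamDrift_apply, conjPerm_apply, conjTranspose_permOp, mul_smul_comm, smul_mul_assoc]
  congr 1
  rw [mul_sub, sub_mul]
  congr 1
  · rw [← mul_assoc, ← mul_assoc, h.eq, mul_assoc (permOp π) H]
  · rw [mul_assoc, ← hs.eq]; simp only [mul_assoc]

/-- The unordered pairs of qubits, written in increasing order. -/
abbrev Pair (n : ℕ) : Type := {p : Fin n × Fin n // p.1 < p.2}

/-- The master equation with a permutation-invariant Hamiltonian as a consensus system: the active
indices are the edges of the interaction graph. -/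
noncomputable def masterSystem {n : ℕ} (ħ : ℝ) {α : Sym2 (Fin n) → ℝ}
    (hα : ∀ j k : Fin n, j ≠ k → 0 < α s(j, k)) {H : Op n} (hH : H.IsHermitian)
    (hcomm : ∀ π : Equiv.Perm (Fin n), Commute H (permOp π)) :
    ConsensusSystem (Op n) (Pair n) where
  drift := hamDrift ħ H
  act e := conjPerm (Equiv.swap e.1.1 e.1.2)
  weight e := α s(e.1.1, e.1.2)
  inner_drift := inner_hamDrift ħ hH
  norm_act _ := norm_conjPerm _
  drift_act _ := hamDrift_conjPerm ħ (hcomm _) (hcomm _)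
  weight_pos e := hα _ _ e.2.ne

open Classical in
/-- The edges of a graph, written in increasing order. -/
noncomputable def edgePairs {n : ℕ} (G : SimpleGraph (Fin n)) : Finset (Pair n) :=
  Finset.univ.filter fun e => G.Adj e.1.1 e.1.2

theorem mem_edgePairs {n : ℕ} {G : SimpleGraph (Fin n)} {e : Pair n} :
    e ∈ edgePairs G ↔ G.Adj e.1.1 e.1.2 := by simp [edgePairs]

section
variable {n : ℕ} (ħ : ℝ) {α : Sym2 (Fin n) → ℝ}
    (hα : ∀ j k : Fin n, j ≠ k → 0 < α s(j, k)) {H : Op n} (hH : H.IsHermitian)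
    (hcomm : ∀ π : Equiv.Perm (Fin n), Commute H (permOp π))

theorem field_masterSystem (G : SimpleGraph (Fin n)) (ρ : Op n) :
    (masterSystem ħ hα hH hcomm).field (edgePairs G) ρ = masterRHS ħ H α G ρ := by
  classical
  rw [ConsensusSystem.field, masterRHS]
  congr 1
  symm
  refine Finset.sum_bij' (fun p hp => (⟨p, (Finset.mem_filter.1 hp).2.1⟩ : Pair n))
    (fun e _ => e.1) ?_ ?_ ?_ ?_ ?_
  · intro p hp; exact mem_edgePairs.2 (Finset.mem_filter.1 hp).2.2
  · intro e he; exact Finset.mem_filter.2 ⟨Finset.mem_univ _, e.2, mem_edgePairs.1 he⟩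
  · intros; rfl
  · intros; rfl
  · intro p hp
    exact (Complex.coe_smul _ _)

/-- The transpositions along the edges of a connected graph generate all transpositions. -/
theorem conjPerm_swap_of_mem_fixedSpace {J : Finset (Pair n)} {G : SimpleGraph (Fin n)}
    (hJ : edgePairs G ⊆ J) (hG : G.Connected) {A : Op n}
    (hA : A ∈ (masterSystem ħ hα hH hcomm).fixedSpace J) (j k : Fin n) :
    conjPerm (Equiv.swap j k) A = A := by
  have hrefl : ∀ j, conjPerm (Equiv.swap j j) A = A := fun j => by
    ext r q; simp [conjPerm_apply_apply]
  have hadj : ∀ j k, G.Adj j k → conjPerm (Equiv.swap j k) A = A := by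
    intro j k h
    rcases lt_or_gt_of_ne h.ne with hlt | hlt
    · exact hA ⟨(j, k), hlt⟩ (hJ (mem_edgePairs.2 h))
    · rw [Equiv.swap_comm]
      exact hA ⟨(k, j), hlt⟩ (hJ (mem_edgePairs.2 h.symm))
  obtain ⟨p⟩ := hG.preconnected j k
  induction p with
  | nil => exact hrefl _
  | @cons a b c h p ih =>
    by_cases hac : a = c
    · rw [hac]; exact hrefl _
    have hab := hadj _ _ h
    have := Equiv.swap_mul_swap_mul_swap (x := c) (y := b) (z := a)
    by_cases hcb : c = b
    · rw [hcb]; exact hab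
    rw [← this hcb (Ne.symm hac), conjPerm_mul, conjPerm_mul, Equiv.swap_comm b a, hab,
      Equiv.swap_comm c b, ih, hab]

theorem fixedSpace_eq_of_connected {J : Finset (Pair n)} {G : SimpleGraph (Fin n)}
    (hJ : edgePairs G ⊆ J) (hG : G.Connected) :
    (masterSystem ħ hα hH hcomm).fixedSpace J =
      (masterSystem ħ hα hH hcomm).fixedSpace Finset.univ := by
  refine le_antisymm (fun A hA e _ => ?_) (fun A hA e _ => hA e (Finset.mem_univ _))
  exact conjPerm_swap_of_mem_fixedSpace ħ hα hH hcomm hJ hG hA _ _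

end

theorem reducedState_eq_of_conjPerm_swap {n : ℕ} {A : Op n} {k m : Fin n}
    (hA : conjPerm (Equiv.swap k m) A = A) : reducedState k A = reducedState m A := by
  classical
  have hfun : ∀ (k : Fin n) (a : Fin 2) (s : {j : Fin n // j ≠ k} → Fin 2) (i : Fin n),
    (Equiv.funSplitAt k (Fin 2)).symm (a, s) i = if h : i = k then a else s ⟨i, h⟩ := by
    intro k a s i
    simp [Equiv.funSplitAt, Equiv.piSplitAt]
  -- The transposition of `k` and `m` relabels the qubits other than `m` as those other than `k`.
  let e : {j : Fin n // j ≠ m} ≃ {j : Fin n // j ≠ k} :=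
    (Equiv.swap k m).subtypeEquiv fun j => by
      rw [not_iff_not, Equiv.swap_apply_eq_iff, Equiv.swap_apply_left]
  have hcomp : ∀ (a : Fin 2) (s : {j : Fin n // j ≠ k} → Fin 2),
      (Equiv.funSplitAt k (Fin 2)).symm (a, s) ∘ (Equiv.swap k m).symm =
        (Equiv.funSplitAt m (Fin 2)).symm (a, s ∘ e) := by
    intro a s
    ext i
    rw [Function.comp_apply, hfun, hfun, Equiv.symm_swap]
    by_cases h : i = m
    · simp [h]
    · have h' : Equiv.swap k m i ≠ k := by
        rwa [Ne, Equiv.swap_apply_eq_iff, Equiv.swap_apply_left]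
      rw [dif_neg h, dif_neg h']
      rfl
  ext a b
  refine (Finset.sum_congr rfl fun s _ => ?_).trans
    (Equiv.sum_comp (Equiv.arrowCongr e.symm (Equiv.refl (Fin 2))) fun s =>
      A ((Equiv.funSplitAt m (Fin 2)).symm (a, s)) ((Equiv.funSplitAt m (Fin 2)).symm (b, s)))
  conv_lhs => rw [← hA]
  rw [conjPerm_apply_apply, hcomp, hcomp]
  rfl

/-- The difference of the reduced states of the qubits `k` and `m`, as a linear map. -/
def reducedStateDiff {n : ℕ} (k m : Fin n) : Op n →ₗ[ℝ] Matrix (Fin 2) (Fin 2) ℂ where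
  toFun A := reducedState k A - reducedState m A
  map_add' A B := by
    ext a b
    simp only [reducedState, of_apply, Matrix.add_apply, Matrix.sub_apply, Finset.sum_add_distrib]
    ring
  map_smul' c A := by
    ext a b
    simp only [reducedState, of_apply, Matrix.smul_apply, Matrix.sub_apply, ← Finset.smul_sum,
      smul_sub, RingHom.id_apply]

/-! ### Synchronization of the reduced states -/

section

variable {n : ℕ} {σ : ℝ → SimpleGraph (Fin n)}

theorem unionGraph_adj {S : Set ℝ} {j k : Fin n} :
    (unionGraph σ S).Adj j k ↔ ∃ t ∈ S, (σ t).Adj j k := by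
  simp [unionGraph, SimpleGraph.iSup_adj]

theorem exists_connected_unionGraph_Ico {t : ℝ} (h : (unionGraph σ (Ici t)).Connected) :
    ∃ T : ℝ, 0 < T ∧ (unionGraph σ (Ico t (t + T))).Connected := by
  have h1 : ∀ p : Fin n × Fin n, ∃ s : ℝ, (unionGraph σ (Ici t)).Adj p.1 p.2 →
      s ∈ Ici t ∧ (σ s).Adj p.1 p.2 := fun p => by
    by_cases hp : (unionGraph σ (Ici t)).Adj p.1 p.2
    · obtain ⟨s, hs⟩ := unionGraph_adj.1 hp
      exact ⟨s, fun _ => hs⟩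
    · exact ⟨0, fun h => absurd h hp⟩
  choose f hf using h1
  obtain ⟨M, hM⟩ := Finite.exists_le f
  have hT : 0 < max 0 (M - t) + 1 := by positivity
  refine ⟨_, hT, h.mono fun j k hjk => ?_⟩
  obtain ⟨h2, h3⟩ := hf (j, k) hjk
  exact unionGraph_adj.2 ⟨_, ⟨h2, by linarith [hM (j, k), le_max_right 0 (M - t)]⟩, h3⟩

variable (ħ : ℝ) {α : Sym2 (Fin n) → ℝ}
    (hα : ∀ j k : Fin n, j ≠ k → 0 < α s(j, k)) {H : Op n} (hH : H.IsHermitian)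
    (hcomm : ∀ π : Equiv.Perm (Fin n), Commute H (permOp π))

/-- The squared Hilbert-Schmidt distance from `ρ` to the permutation-invariant operators. -/
noncomputable def asymmetry (ρ : Op n) : ℝ :=
  (masterSystem ħ hα hH hcomm).disagreement Finset.univ ρ

/-- After any time `t₁` there is a time `t'`, reached within `2τ`, such that every time window from
`t'` on with a connected union graph, prolonged by `τ`, contracts the asymmetry by the factor `q`.
The time `t'` lies inside a piece of which at least `τ/2` has passed since `t₁` and at least `τ/2` is
still to come, so that the value of `σ` at a switching instant is that of a piece in the window. -/
theorem exists_contraction_window (hσ : IsSwitchingSignal σ) :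
    ∃ τ q : ℝ, 0 < τ ∧ 0 < q ∧ q < 1 ∧ ∀ t₀ : ℝ, 0 ≤ t₀ → ∀ ρ : ℝ → Op n,
      IsSolution ħ H α σ t₀ ρ →
      AntitoneOn (fun t => asymmetry ħ hα hH hcomm (ρ t)) (Ici t₀) ∧
      ∀ t₁ : ℝ, t₀ ≤ t₁ → ∃ t' : ℝ, t₁ ≤ t' ∧ t' ≤ t₁ + 2 * τ ∧ ∀ T : ℝ, 0 < T →
        (unionGraph σ (Ico t' (t' + T))).Connected →
        asymmetry ħ hα hH hcomm (ρ (t' + T + τ)) ≤ q * asymmetry ħ hα hH hcomm (ρ t₁) := by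
  obtain ⟨τ, s, g, hτ, hs0, hs, hg, -, hgs⟩ := hσ
  obtain ⟨q, hq0, hq1, hq⟩ := (masterSystem ħ hα hH hcomm).exists_contraction hτ
  have hmono : StrictMono s := strictMono_nat_of_lt_succ fun k => by linarith [hs k]
  have hlin : ∀ k : ℕ, k * τ ≤ s k := by
    intro k
    induction k with
    | zero => simp [hs0]
    | succ k ih => push_cast; linarith [hs k]
  have hlim : Tendsto s atTop atTop :=
    tendsto_atTop_mono hlin (tendsto_natCast_atTop_atTop.atTop_mul_const hτ)
  have hpiece : ∀ t : ℝ, 0 ≤ t → ∃ k, s k ≤ t ∧ t < s (k + 1) := by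
    intro t ht
    have hex := (hlim.eventually_gt_atTop t).exists
    classical
    obtain ⟨k, hk⟩ : ∃ k, Nat.find hex = k + 1 := by
      refine Nat.exists_eq_succ_of_ne_zero fun h0 => ?_
      have := Nat.find_spec hex
      rw [h0, hs0] at this
      linarith
    exact ⟨k, not_lt.1 (Nat.find_min hex (by omega)), hk ▸ Nat.find_spec hex⟩
  refine ⟨τ, q, hτ, hq0, hq1, fun t₀ ht₀ ρ hρ => ?_⟩
  have hd : ∀ k, ∀ t ∈ Ioo (s k) (s (k + 1)), t₀ < t → HasDerivAt ρ
      ((masterSystem ħ hα hH hcomm).field (edgePairs (g k)) (ρ t)) t := by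
    intro k t ht htt
    rw [field_masterSystem, ← hg k t ht]
    refine hρ.hasDerivAt t htt ?_
    filter_upwards [isOpen_Ioo.mem_nhds ht] with r hr
    rw [hg k t ht, hg k r hr]
  have hV : AntitoneOn (fun t => asymmetry ħ hα hH hcomm (ρ t)) (Ici t₀) :=
    ConsensusSystem.antitoneOn_disagreement_Ici hτ hs (hs0.trans_le ht₀) hlim hρ.continuousOn hd
  refine ⟨hV, fun t₁ ht₁ => ?_⟩
  obtain ⟨A, a, htA, hAt, haA, hAa⟩ :
      ∃ (A : ℝ) (a : ℕ), t₁ ≤ A ∧ A ≤ t₁ + τ ∧ s a ≤ A ∧ A + τ ≤ s (a + 1) := by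
    obtain ⟨k, hk1, hk2⟩ := hpiece t₁ (ht₀.trans ht₁)
    rcases le_total (t₁ + τ) (s (k + 1)) with h | h
    · exact ⟨t₁, k, le_rfl, by linarith, hk1, h⟩
    · exact ⟨s (k + 1), k + 1, hk2.le, h, le_rfl, hs (k + 1)⟩
  refine ⟨A + τ / 2, by linarith, by linarith, fun T hT hconn => ?_⟩
  have hex : ∃ m, A + τ / 2 + T < s (a + m) :=
    ((hlim.comp (tendsto_atTop_mono (fun m => Nat.le_add_left m a)
      tendsto_id)).eventually_gt_atTop _).exists
  classical
  set m := Nat.find hex with hm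
  have hsub : unionGraph σ (Ico (A + τ / 2) (A + τ / 2 + T)) ≤
      ⨆ j ∈ Finset.range m, g (a + j) := by
    have hle : ∀ k, a ≤ k → s k ≤ A + τ / 2 + T →
        g k ≤ ⨆ j ∈ Finset.range m, g (a + j) := by
      intro k hk hkT
      obtain ⟨j, rfl⟩ := Nat.exists_eq_add_of_le hk
      refine le_iSup₂_of_le (f := fun j (_ : j ∈ Finset.range m) => g (a + j)) j ?_ le_rfl
      by_contra hj
      rw [Finset.mem_range, not_lt] at hj
      have h1 := Nat.find_spec hex
      have h2 := hmono.monotone (Nat.add_le_add_left hj a)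
      linarith
    refine iSup₂_le fun t ht => ?_
    obtain ⟨k, hk1, hk2⟩ := hpiece t (by linarith [ht.1])
    have hka : a ≤ k := by
      by_contra h
      have := hmono.monotone (show k + 1 ≤ a by omega)
      linarith [ht.1]
    rcases hk1.eq_or_lt with h | h
    -- At the switching instant `t = s k` the signal may take the value of the piece `k - 1`.
    · have hka' : a ≠ k := fun h' => by
        rw [h'] at haA
        linarith [ht.1]
      obtain ⟨l, rfl⟩ : ∃ l, k = l + 1 := ⟨k - 1, by omega⟩
      rw [← h]
      rcases hgs l with h' | h' <;> rw [h']
      · exact hle l (by omega) (by linarith [hmono (Nat.lt_succ_self l), ht.2])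
      · exact hle _ hka (by linarith [ht.2])
    · rw [hg k t ⟨h, hk2⟩]
      exact hle k hka (by linarith [ht.2])
  have hfix : (masterSystem ħ hα hH hcomm).fixedSpace
      ((Finset.range m).biUnion fun j => edgePairs (g (a + j))) =
      (masterSystem ħ hα hH hcomm).fixedSpace Finset.univ := by
    refine fixedSpace_eq_of_connected ħ hα hH hcomm (fun e he => ?_) (hconn.mono hsub)
    have := mem_edgePairs.1 he
    simp only [SimpleGraph.iSup_adj] at this
    obtain ⟨j, hj, h⟩ := this
    exact Finset.mem_biUnion.2 ⟨j, hj, mem_edgePairs.2 h⟩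
  refine (ConsensusSystem.disagreement_le_of_window hq hmono.monotone hs hρ.continuousOn hd hV hτ
    (ht₁.trans htA) haA hAa (B := A + τ / 2 + T + τ) (by linarith) (fun j hj => ?_)
    hfix).trans ?_
  · linarith [not_lt.1 (Nat.find_min hex hj)]
  · exact mul_le_mul_of_nonneg_left (hV ht₁ (ht₁.trans htA) htA) hq0.le

/-- The permutation-invariant part of `ρ` has equal reduced states and drops out of the difference,
which is therefore a linear function of the remaining part. -/
theorem exists_norm_reducedState_sub_le : ∃ C : ℝ, 0 ≤ C ∧ ∀ (k m : Fin n) (ρ : Op n),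
    ‖reducedState k ρ - reducedState m ρ‖ ≤ C * √(asymmetry ħ hα hH hcomm ρ) := by
  choose c hc0 hc using fun p : Fin n × Fin n =>
    LinearMap.exists_norm_le_of_finiteDimensional (reducedStateDiff p.1 p.2)
  refine ⟨∑ p, c p, Finset.sum_nonneg fun p _ => hc0 p, fun k m ρ => ?_⟩
  set S := masterSystem ħ hα hH hcomm with hS
  have : Nonempty (Fin n) := ⟨k⟩
  have h1 : reducedStateDiff k m (ρ - S.residual Finset.univ ρ) = 0 :=
    sub_eq_zero.2 (reducedState_eq_of_conjPerm_swap (conjPerm_swap_of_mem_fixedSpace ħ hα hH hcomm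
      (Finset.subset_univ (edgePairs ⊤)) SimpleGraph.connected_top
      (S.sub_residual_mem Finset.univ ρ) k m))
  rw [map_sub, sub_eq_zero] at h1
  have h2 : √(asymmetry ħ hα hH hcomm ρ) = ‖S.residual Finset.univ ρ‖ :=
    Real.sqrt_sq (norm_nonneg _)
  rw [h2]
  calc ‖reducedState k ρ - reducedState m ρ‖ = ‖reducedStateDiff k m (S.residual Finset.univ ρ)‖ :=
        congrArg norm h1
    _ ≤ c (k, m) * ‖S.residual Finset.univ ρ‖ := hc (k, m) _
    _ ≤ _ := mul_le_mul_of_nonneg_right (Finset.single_le_sum (fun p _ => hc0 p)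
      (Finset.mem_univ (k, m))) (norm_nonneg _)

end

theorem asymptoticSync {n : ℕ} {σ : ℝ → SimpleGraph (Fin n)} (ħ : ℝ) {α : Sym2 (Fin n) → ℝ}
    (hα : ∀ j k : Fin n, j ≠ k → 0 < α s(j, k)) {H : Op n} (hH : H.IsHermitian)
    (hcomm : ∀ π : Equiv.Perm (Fin n), Commute H (permOp π)) (hσ : IsSwitchingSignal σ)
    (hconn : ∀ t : ℝ, 0 ≤ t → (unionGraph σ (Ici t)).Connected) : AsymptoticSync ħ H α σ := by
  intro t₀ ht₀ ρ hρ k m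
  obtain ⟨τ, q, hτ, hq0, hq1, h⟩ := exists_contraction_window ħ hα hH hcomm hσ
  obtain ⟨hV, hw⟩ := h t₀ ht₀ ρ hρ
  obtain ⟨C, hC0, hC⟩ := exists_norm_reducedState_sub_le ħ hα hH hcomm
  set V : ℝ → ℝ := fun t => asymmetry ħ hα hH hcomm (ρ t) with hVdef
  have hV0 : ∀ t, 0 ≤ V t := fun t => sq_nonneg _
  have hpow : ∀ N : ℕ, ∃ t, t₀ ≤ t ∧ V t ≤ V t₀ * q ^ N := by
    intro N
    induction N with
    | zero => exact ⟨t₀, le_rfl, by simp⟩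
    | succ N ih =>
      obtain ⟨t, ht, hVt⟩ := ih
      obtain ⟨t', ht', -, hT⟩ := hw t ht
      obtain ⟨T, hT0, hTc⟩ :=
        exists_connected_unionGraph_Ico (hconn t' (ht₀.trans (ht.trans ht')))
      refine ⟨t' + T + τ, by linarith, (hT T hT0 hTc).trans ?_⟩
      rw [pow_succ']
      calc q * V t ≤ q * (V t₀ * q ^ N) := mul_le_mul_of_nonneg_left hVt hq0.le
        _ = V t₀ * (q * q ^ N) := by ring
  have hlim : Tendsto V atTop (𝓝 0) := by
    have hp : Tendsto (fun N : ℕ => V t₀ * q ^ N) atTop (𝓝 0) := by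
      simpa using (tendsto_pow_atTop_nhds_zero_of_lt_one hq0.le hq1).const_mul (V t₀)
    refine Metric.tendsto_atTop.2 fun ε hε => ?_
    obtain ⟨N, hN⟩ := (hp.eventually_lt_const hε).exists
    obtain ⟨t, ht, hVt⟩ := hpow N
    refine ⟨t, fun r hr => ?_⟩
    rw [Real.dist_0_eq_abs, abs_of_nonneg (hV0 r)]
    exact ((hV ht (ht.trans hr) hr).trans hVt).trans_lt hN
  refine squeeze_zero_norm (fun t => hC k m (ρ t)) ?_
  simpa using (hlim.sqrt.const_mul C)

theorem exponentialSync {n : ℕ} {σ : ℝ → SimpleGraph (Fin n)} (ħ : ℝ) {α : Sym2 (Fin n) → ℝ}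
    (hα : ∀ j k : Fin n, j ≠ k → 0 < α s(j, k)) {H : Op n} (hH : H.IsHermitian)
    (hcomm : ∀ π : Equiv.Perm (Fin n), Commute H (permOp π)) (hσ : IsSwitchingSignal σ)
    {T : ℝ} (hT : 0 < T)
    (hconn : ∀ t : ℝ, 0 ≤ t → (unionGraph σ (Ico t (t + T))).Connected) :
    ExponentialSync ħ H α σ := by
  obtain ⟨τ, q, hτ, hq0, hq1, h⟩ := exists_contraction_window ħ hα hH hcomm hσ
  obtain ⟨C, hC0, hC⟩ := exists_norm_reducedState_sub_le ħ hα hH hcomm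
  -- A waiting time of at most `2τ`, the window of length `T`, and its prolongation by `τ`.
  set P := T + 3 * τ with hP
  have hP0 : 0 < P := by positivity
  have hlog : Real.log q < 0 := Real.log_neg hq0 hq1
  refine ⟨-Real.log q / (2 * P), div_pos (neg_pos.2 hlog) (by positivity), fun ρ₀ => ?_⟩
  refine ⟨C * √(q⁻¹ * asymmetry ħ hα hH hcomm ρ₀) + 1, by positivity,
    fun t₀ ht₀ ρ hρ hinit k m t ht => ?_⟩
  obtain ⟨hV, hw⟩ := h t₀ ht₀ ρ hρ
  set V : ℝ → ℝ := fun t => asymmetry ħ hα hH hcomm (ρ t) with hVdef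
  have hV0 : ∀ t, 0 ≤ V t := fun t => sq_nonneg _
  have hpow : ∀ N : ℕ, V (t₀ + N * P) ≤ q ^ N * V t₀ := by
    intro N
    induction N with
    | zero => simp
    | succ N ih =>
      have h1 : t₀ ≤ t₀ + N * P := le_add_of_nonneg_right (by positivity)
      obtain ⟨t', ht', ht'', hT'⟩ := hw _ h1
      have h2 := hT' T hT (hconn t' (ht₀.trans (h1.trans ht')))
      have h3 : V (t₀ + (N + 1 : ℕ) * P) ≤ V (t' + T + τ) := by
        refine hV (mem_Ici.2 (by linarith)) (mem_Ici.2 ?_) ?_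
        · exact le_add_of_nonneg_right (by positivity)
        · push_cast; linarith
      calc _ ≤ q * V (t₀ + N * P) := h3.trans h2
        _ ≤ q * (q ^ N * V t₀) := mul_le_mul_of_nonneg_left ih hq0.le
        _ = _ := by ring
  set N := ⌊(t - t₀) / P⌋₊ with hN
  have hN1 : N * P ≤ t - t₀ :=
    (le_div_iff₀ hP0).1 (Nat.floor_le (div_nonneg (sub_nonneg.2 ht) hP0.le))
  have hN2 : (t - t₀) / P < N + 1 := Nat.lt_floor_add_one _
  have hqN : q ^ N ≤ q⁻¹ * Real.exp (-(-Real.log q / (2 * P)) * (t - t₀)) ^ 2 := by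
    have h1 : q ^ N = q⁻¹ * Real.exp ((N + 1 : ℝ) * Real.log q) := by
      rw [add_mul, Real.exp_add, one_mul, Real.exp_log hq0, mul_comm (N : ℝ), Real.exp_mul,
        Real.exp_log hq0, Real.rpow_natCast]
      field_simp
    rw [h1, ← Real.exp_nat_mul]
    refine mul_le_mul_of_nonneg_left (Real.exp_le_exp.2 ?_) (inv_nonneg.2 hq0.le)
    have h2 : ((2 : ℕ) : ℝ) * (-(-Real.log q / (2 * P)) * (t - t₀)) =
        (t - t₀) / P * Real.log q := by
      push_cast; field_simp
    rw [h2]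
    exact mul_le_mul_of_nonpos_right hN2.le hlog.le
  have hVt : V t ≤ (q⁻¹ * V t₀) * Real.exp (-(-Real.log q / (2 * P)) * (t - t₀)) ^ 2 := by
    have h1 : V t ≤ V (t₀ + N * P) :=
      hV (mem_Ici.2 (le_add_of_nonneg_right (by positivity))) ht (by linarith)
    calc V t ≤ q ^ N * V t₀ := h1.trans (hpow N)
      _ ≤ _ := mul_le_mul_of_nonneg_right hqN (hV0 t₀)
      _ = _ := by ring
  have hsqrt : √(V t) ≤ √(q⁻¹ * V t₀) * Real.exp (-(-Real.log q / (2 * P)) * (t - t₀)) := by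
    refine (Real.sqrt_le_sqrt hVt).trans_eq ?_
    rw [Real.sqrt_mul (mul_nonneg (inv_nonneg.2 hq0.le) (hV0 t₀)),
      Real.sqrt_sq (Real.exp_pos _).le]
  have hVρ : V t₀ = asymmetry ħ hα hH hcomm ρ₀ := by rw [← hinit]
  rw [← hVρ, add_mul, mul_assoc]
  exact ((hC k m (ρ t)).trans (mul_le_mul_of_nonneg_left hsqrt hC0)).trans
    (le_add_of_nonneg_right (by positivity))

/-! ### Permutation-invariant Hamiltonians -/

theorem permOp_mul_tensorOp {n : ℕ} (π : Equiv.Perm (Fin n))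
    (A : Fin n → Matrix (Fin 2) (Fin 2) ℂ) :
    permOp π * tensorOp A = tensorOp (A ∘ π) * permOp π := by
  ext r q
  rw [permOp_mul_apply, mul_permOp_apply, tensorOp, tensorOp, of_apply, of_apply,
    ← Equiv.prod_comp π]
  simp

theorem commute_tensorPow {n : ℕ} (H₀ : Matrix (Fin 2) (Fin 2) ℂ) (π : Equiv.Perm (Fin n)) :
    Commute (tensorPow n H₀) (permOp π) :=
  (permOp_mul_tensorOp π fun _ => H₀).symm

theorem commute_kroneckerSum {n : ℕ} (H₀ : Matrix (Fin 2) (Fin 2) ℂ) (π : Equiv.Perm (Fin n)) :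
    Commute (kroneckerSum n H₀) (permOp π) := by
  rw [commute_iff_eq, kroneckerSum, Finset.sum_mul, Finset.mul_sum]
  refine (Finset.sum_congr rfl fun i _ => ?_).trans (Equiv.sum_comp π fun i =>
    permOp π * tensorOp (Function.update (fun _ => 1) i H₀))
  rw [permOp_mul_tensorOp, Function.update_comp_eq_of_injective _ π.injective]
  rfl

end QubitNetwork

theorem theorem6 {n : ℕ} (ħ : ℝ) (hħ : 0 < ħ)
    (α : Sym2 (Fin n) → ℝ) (hα : ∀ j k : Fin n, j ≠ k → 0 < α s(j, k))
    (σ : ℝ → SimpleGraph (Fin n)) (hσ : QubitNetwork.IsSwitchingSignal σ) :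
    (∀ H : QubitNetwork.Op n, H.IsHermitian →
      (∀ π : Equiv.Perm (Fin n), Commute H (QubitNetwork.permOp π)) →
      ((∀ t : ℝ, 0 ≤ t → (QubitNetwork.unionGraph σ (Set.Ici t)).Connected) →
        QubitNetwork.AsymptoticSync ħ H α σ) ∧
      ((∃ T : ℝ, 0 < T ∧
          ∀ t : ℝ, 0 ≤ t → (QubitNetwork.unionGraph σ (Set.Ico t (t + T))).Connected) →
        QubitNetwork.ExponentialSync ħ H α σ)) ∧
    (∀ H₀ : Matrix (Fin 2) (Fin 2) ℂ, H₀.IsHermitian → ∀ π : Equiv.Perm (Fin n),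
      Commute (QubitNetwork.tensorPow n H₀) (QubitNetwork.permOp π) ∧
      Commute (QubitNetwork.kroneckerSum n H₀) (QubitNetwork.permOp π)) :=
  ⟨fun _ hH hcomm => ⟨QubitNetwork.asymptoticSync ħ hα hH hcomm hσ,
      fun ⟨_, hT, hconn⟩ => QubitNetwork.exponentialSync ħ hα hH hcomm hσ hT hconn⟩,
    fun H₀ _ π => ⟨QubitNetwork.commute_tensorPow H₀ π, QubitNetwork.commute_kroneckerSum H₀ π⟩⟩
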